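/- Let $d \ge 1$ be an integer and let $0 \le \epsilon < \delta$ be real numbers. For $\Phi \in \mathbb{R}^{k\times d}$ let $\mathcal{H}_\Phi^\epsilon = \{\Phi\theta : \theta\in\mathbb{R}^d\} + [-\epsilon,\epsilon]^k \subset \mathbb{R}^k$. A learner on $k$ actions sequentially and adaptively queries actions $i \in \{1,\dots,k\}$ of an unknown reward vector $\mu\in\mathbb{R}^k$, observing $\mu_i$ without noise after each query; at some point it stops and outputs an action $\hat a$ and a vector $\hat\mu\in\mathbb{R}^k$. It may randomise. It is called max-sound for $(\mathcal{H},\delta)$, where $\mathcal{H}\subset\mathbb{R}^k$, if for every $\mu\in\mathcal{H}$ it almost surely stops and $\mu_{\hat a} > \max_{i} \mu_i - \delta$. Let $$c_\delta^{\max}(\mathcal{H}) = \inf_{\mathscr{A}} \sup_{\mu\in\mathcal{H}} q(\mathscr{A},\mu),$$ where the infimum is over all learners $\mathscr{A}$ that are max-sound for $(\mathcal{H},\delta)$ and $q(\mathscr{A},\mu)\in[0,\infty]$ is the expected number of queries that $\mathscr{A}$ makes when the reward vector is $\mu$. Then for every sufficiently large integer $k$ (depending on $d,\epsilon,\delta$)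 there exists a feature matrix $\Phi\in\mathbb{R}^{k\times d}$ such that $$c_\delta^{\max}(\mathcal{H}_\Phi^\epsilon) \;\ge\; \frac12 \exp\left(\frac{d-1}{8}\left(\frac{\epsilon}{\delta}\right)^2\right).$$ -/

import Mathlib

open MeasureTheory
open scoped ENNReal Pointwise

noncomputable section

namespace MisspecifiedBandit

/-- What a learner does next on `k` actions: either query an action (`Sum.inl i`), or stop and
output an estimated optimal action together with an estimate of the reward vector
(`Sum.inr (a, m)`). -/
abbrev Decision (k : ℕ) : Type := Fin k ⊕ (Fin k × (Fin k → ℝ))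

/-- A (possibly randomised) sequential learner on `k` actions. A random seed `ω` is drawn from a
probability space; given the seed, the next decision is a function of the finite list of queried
actions and observed rewards so far. For every possible history the decision is a random
variable. The learner may adapt to the observations, repeat queries, and may fail to stop. -/
structure Learner (k : ℕ) where
  Seed : Type
  [seedSpace : MeasurableSpace Seed]
  law : Measure Seed
  [isProb : IsProbabilityMeasure law]
  decide : Seed → List (Fin k × ℝ) → Decision k
  measurable_decide : ∀ h : List (Fin k × ℝ), Measurable fun ω => decide ω h

attribute [instance] Learner.seedSpace Learner.isProb

namespace Learner

variable {k : ℕ}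

/-- The history after `t` rounds of interaction with the noiseless reward vector `μ`. The oldest
observation comes first, and the history no longer changes once the learner has stopped. -/
def history (A : Learner k) (μ : Fin k → ℝ) (ω : A.Seed) : ℕ → List (Fin k × ℝ)
  | 0 => []
  | t + 1 =>
    match A.decide ω (A.history μ ω t) with
    | Sum.inl i => A.history μ ω t ++ [(i, μ i)]
    | Sum.inr _ => A.history μ ω t

/-- On the seed `ω` and the reward vector `μ`, the learner stops and outputs the action `a` and
the estimate `m`. -/
def Outputs (A : Learner k) (μ : Fin k → ℝ) (ω : A.Seed) (a : Fin k) (m : Fin k → ℝ) : Prop :=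
  ∃ t : ℕ, A.decide ω (A.history μ ω t) = Sum.inr (a, m)

/-- The total number of queries made on the seed `ω` and the reward vector `μ`
(it is `∞` if the learner never stops). -/
def numQueries (A : Learner k) (μ : Fin k → ℝ) (ω : A.Seed) : ℝ≥0∞ :=
  ⨆ t : ℕ, ((A.history μ ω t).length : ℝ≥0∞)

/-- The expected number of queries made when interacting with `μ`. -/
def expectedQueries (A : Learner k) (μ : Fin k → ℝ) : ℝ≥0∞ :=
  ∫⁻ ω, A.numQueries μ ω ∂A.law

end Learner

/-- The action `a` is `δ`-optimal for `μ`: `μ_a > max_i μ_i - δ`. The supremum is over the finite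
set of actions (nonempty, since it contains `a`), so it is a maximum. -/
def IsNearOptimal {k : ℕ} (δ : ℝ) (μ : Fin k → ℝ) (a : Fin k) : Prop :=
  μ a > (⨆ i, μ i) - δ

/-- The learner is max-sound for `(H, δ)`: for all `μ ∈ H`, almost surely it stops and outputs a
`δ`-optimal action. -/
def Learner.MaxSound {k : ℕ} (A : Learner k) (H : Set (Fin k → ℝ)) (δ : ℝ) : Prop :=
  ∀ μ ∈ H, ∀ᵐ ω ∂A.law, ∃ (a : Fin k) (m : Fin k → ℝ), A.Outputs μ ω a m ∧ IsNearOptimal δ μ a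

/-- The minimax query complexity `c_δ^max(H)`: the infimum over learners that are max-sound for
`(H, δ)` of the worst-case expected number of queries over `H`. -/
def queryComplexity {k : ℕ} (δ : ℝ) (H : Set (Fin k → ℝ)) : ℝ≥0∞ :=
  ⨅ (A : Learner k) (_ : A.MaxSound H δ), ⨆ μ ∈ H, A.expectedQueries μ

/-- The hypothesis class `H_Φ^ε = Range Φ + [-ε, ε]^k` (Minkowski sum). -/
def hypothesisClass {k d : ℕ} (Φ : Matrix (Fin k) (Fin d) ℝ) (ε : ℝ) : Set (Fin k → ℝ) :=
  Set.range (fun θ : Fin d → ℝ => Φ.mulVec θ) +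
    Set.Icc (fun _ : Fin k => -ε) (fun _ : Fin k => ε)

end MisspecifiedBandit

end

/-! Needle in a haystack. Among random sign vectors of dimension `d`, Hoeffding's inequality and
greedy packing give exponentially many whose pairwise inner products are at most `(ε / δ) * d` in
absolute value. With these as feature rows, the parameter `(δ / d) • f i` predicts exactly `δ` at
action `i` and at most `ε` in absolute value elsewhere, so the needle `Pi.single i δ` lies in the
class (`exists_single_mem_hypothesisClass`).

A needle's only `δ`-optimal action is its own, and until that action is queried the run coincides
with the run on the zero vector. For a fixed seed, fewer than `c` queries therefore find at most `c
+ 1` needles. Averaging over `2 * (c + 1)` needles, and then over the seed, leaves some needle with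
expected cost at least `c / 2` (`le_queryComplexity_of_single_mem`). A small target bound needs only
a single query (`exists_one_le_queryComplexity`). -/

open Finset in
/-- Greedy packing: if every point excludes few points, many points can be chosen that do not
exclude each other. -/
theorem exists_pairwise_of_card_lt {α : Type*} [DecidableEq α] (s : Finset α) (r : α → α → Prop)
    [∀ x y, Decidable (r x y)] (symm : ∀ x y, r x y → r y x) (B : ℝ) (hB0 : 0 ≤ B)
    (hB : ∀ y ∈ s, ((s.filter fun x => r x y).card : ℝ) ≤ B) (n : ℕ) (hn : n * B < s.card) :
    ∃ f : Fin n → α, (∀ i, f i ∈ s) ∧ ∀ i j, i ≠ j → ¬ r (f i) (f j) := by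
  induction n with
  | zero => exact ⟨Fin.elim0, fun i => i.elim0, fun i => i.elim0⟩
  | succ n ih =>
    push_cast at hn
    obtain ⟨f, hf, hr⟩ := ih (by linarith)
    have hcard : ((univ.biUnion fun i => s.filter fun x => r x (f i)).card : ℝ) < s.card := by
      calc ((univ.biUnion fun i => s.filter fun x => r x (f i)).card : ℝ)
          ≤ ∑ i, ((s.filter fun x => r x (f i)).card : ℝ) := by exact_mod_cast card_biUnion_le
        _ ≤ ∑ _i : Fin n, B := sum_le_sum fun i _ => hB _ (hf i)
        _ = n * B := by simp
        _ < s.card := by linarith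
    obtain ⟨x, hx, hxn⟩ := exists_mem_notMem_of_card_lt_card (Nat.cast_lt.mp hcard)
    simp only [mem_biUnion, mem_univ, true_and, mem_filter, not_exists, not_and] at hxn
    refine ⟨Fin.cons x f, Fin.cases hx hf, ?_⟩
    intro i j hij
    cases i using Fin.cases with
    | zero =>
      cases j using Fin.cases with
      | zero => exact absurd rfl hij
      | succ j => simpa using hxn j hx
    | succ i =>
      cases j using Fin.cases with
      | zero => simpa using fun h => hxn i hx (symm _ _ h)
      | succ j => simpa using hr i j (fun h => hij (by rw [h]))

/-! ### Nearly orthogonal sign vectors -/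

/-- The vertices `{1, -1}^d` of the cube. -/
noncomputable def signVectors (d : ℕ) : Finset (Fin d → ℝ) := Fintype.piFinset fun _ => {1, -1}

theorem mem_signVectors {d : ℕ} {x : Fin d → ℝ} :
    x ∈ signVectors d ↔ ∀ i, x i = 1 ∨ x i = -1 := by
  simp [signVectors]

theorem card_signVectors (d : ℕ) : (signVectors d).card = 2 ^ d := by
  rw [signVectors, Fintype.card_piFinset_const, Finset.card_pair (by norm_num)]

theorem dotProduct_self_of_mem_signVectors {d : ℕ} {x : Fin d → ℝ} (hx : x ∈ signVectors d) :
    x ⬝ᵥ x = d := by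
  have (i : Fin d) : x i * x i = 1 := by
    rcases mem_signVectors.mp hx i with h | h <;> simp [h]
  simp [dotProduct, this]

/-- The moment generating function of a Rademacher sum. -/
theorem sum_exp_dotProduct_signVectors {d : ℕ} {y : Fin d → ℝ} (hy : y ∈ signVectors d) (l : ℝ) :
    ∑ x ∈ signVectors d, Real.exp (l * (x ⬝ᵥ y)) = (2 * Real.cosh l) ^ d := by
  have h1 (x : Fin d → ℝ) : Real.exp (l * (x ⬝ᵥ y)) = ∏ i, Real.exp (l * (x i * y i)) := by
    rw [dotProduct, Finset.mul_sum, Real.exp_sum]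
  simp_rw [h1]
  rw [signVectors, ← Finset.prod_univ_sum (fun _ => {1, -1}) fun i b => Real.exp (l * (b * y i))]
  have h2 (i : Fin d) : ∑ b ∈ ({1, -1} : Finset ℝ), Real.exp (l * (b * y i)) = 2 * Real.cosh l := by
    rw [Finset.sum_pair (by norm_num), Real.cosh_eq]
    rcases mem_signVectors.mp hy i with h | h <;> simp [h] <;> ring
  simp [h2]

/-- Hoeffding's inequality for sign vectors, in counting form. -/
theorem card_signVectors_abs_dotProduct_gt_le {d : ℕ} {y : Fin d → ℝ} (hy : y ∈ signVectors d)
    {γ : ℝ} (hγ : 0 ≤ γ) :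
    (((signVectors d).filter fun x => γ * d < |x ⬝ᵥ y|).card : ℝ) ≤
      2 * 2 ^ d * Real.exp (-(d * γ ^ 2 / 2)) := by
  -- Chernoff bound at the optimal parameter `γ`; adding the exponentials at `γ` and `-γ` covers
  -- both tails.
  have key : (((signVectors d).filter fun x => γ * d < |x ⬝ᵥ y|).card : ℝ) *
      Real.exp (d * γ ^ 2) ≤ 2 * 2 ^ d * Real.exp (d * γ ^ 2 / 2) := by
    calc (((signVectors d).filter fun x => γ * d < |x ⬝ᵥ y|).card : ℝ) * Real.exp (d * γ ^ 2)
        = ∑ x ∈ (signVectors d).filter fun x => γ * d < |x ⬝ᵥ y|, Real.exp (d * γ ^ 2) := by simp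
      _ ≤ ∑ x ∈ (signVectors d).filter fun x => γ * d < |x ⬝ᵥ y|,
            (Real.exp (γ * (x ⬝ᵥ y)) + Real.exp (-γ * (x ⬝ᵥ y))) := by
          refine Finset.sum_le_sum fun x hx => ?_
          have hx := (Finset.mem_filter.mp hx).2
          rcases abs_cases (x ⬝ᵥ y) with ⟨h, -⟩ | ⟨h, -⟩ <;> rw [h] at hx
          · refine le_trans ?_ (le_add_of_nonneg_right (Real.exp_pos _).le)
            exact Real.exp_le_exp.mpr (by nlinarith)
          · refine le_trans ?_ (le_add_of_nonneg_left (Real.exp_pos _).le)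
            exact Real.exp_le_exp.mpr (by nlinarith)
      _ ≤ ∑ x ∈ signVectors d, (Real.exp (γ * (x ⬝ᵥ y)) + Real.exp (-γ * (x ⬝ᵥ y))) :=
          Finset.sum_le_sum_of_subset_of_nonneg (Finset.filter_subset _ _)
            fun _ _ _ => by positivity
      _ = 2 * (2 * Real.cosh γ) ^ d := by
          rw [Finset.sum_add_distrib, sum_exp_dotProduct_signVectors hy,
            sum_exp_dotProduct_signVectors hy, Real.cosh_neg]
          ring
      _ ≤ 2 * (2 * Real.exp (γ ^ 2 / 2)) ^ d := by
          gcongr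
          exact Real.cosh_le_exp_half_sq γ
      _ = 2 * 2 ^ d * Real.exp (d * γ ^ 2 / 2) := by
          rw [mul_pow, ← Real.exp_nat_mul, mul_div_assoc]
          ring
  rw [← le_div_iff₀ (Real.exp_pos _)] at key
  refine key.trans_eq ?_
  rw [mul_div_assoc, ← Real.exp_sub]
  congr 2
  ring

/-- Exponentially many nearly orthogonal sign vectors. -/
theorem exists_nearly_orthogonal_signVectors (d n : ℕ) {γ : ℝ} (hγ : 0 ≤ γ)
    (hn : 2 * n < Real.exp (d * γ ^ 2 / 2)) :
    ∃ f : Fin n → Fin d → ℝ, (∀ i, f i ⬝ᵥ f i = d) ∧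
      ∀ i j, i ≠ j → |f i ⬝ᵥ f j| ≤ γ * d := by
  classical
  obtain ⟨f, hf, hr⟩ := exists_pairwise_of_card_lt (signVectors d)
    (fun x y => γ * d < |x ⬝ᵥ y|) (fun x y h => by rwa [dotProduct_comm])
    (2 * 2 ^ d * Real.exp (-(d * γ ^ 2 / 2))) (by positivity)
    (fun y hy => card_signVectors_abs_dotProduct_gt_le hy hγ) n (by
      rw [card_signVectors, Real.exp_neg]
      have := Real.exp_pos (d * γ ^ 2 / 2)
      push_cast
      rw [← mul_assoc, ← div_eq_mul_inv, div_lt_iff₀ this]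
      have h2 : (0 : ℝ) < 2 ^ d := by positivity
      nlinarith)
  exact ⟨f, fun i => dotProduct_self_of_mem_signVectors (hf i), fun i j h => not_lt.mp (hr i j h)⟩

/-! ### Runs of a learner and their measurability -/

namespace MisspecifiedBandit

namespace Learner

variable {k : ℕ} (A : Learner k) (μ : Fin k → ℝ) (ω : A.Seed)

theorem history_succ_of_stop {t : ℕ} {p} (h : A.decide ω (A.history μ ω t) = Sum.inr p) :
    A.history μ ω (t + 1) = A.history μ ω t := by
  simp only [history, h]

theorem history_succ_of_query {t : ℕ} {i} (h : A.decide ω (A.history μ ω t) = Sum.inl i) :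
    A.history μ ω (t + 1) = A.history μ ω t ++ [(i, μ i)] := by
  simp only [history, h]

theorem history_of_stop_of_le {t s : ℕ} {p} (h : A.decide ω (A.history μ ω t) = Sum.inr p)
    (hts : t ≤ s) : A.history μ ω s = A.history μ ω t := by
  induction s, hts using Nat.le_induction with
  | base => rfl
  | succ s _ ih => rw [← ih, history_succ_of_stop A μ ω (p := p) (by rw [ih, h])]

/-- A learner that stops with `p` outputs nothing else. -/
theorem output_unique {t : ℕ} {p : Fin k × (Fin k → ℝ)} {a m}
    (h : A.decide ω (A.history μ ω t) = Sum.inr p) (hout : A.Outputs μ ω a m) : p.1 = a := by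
  obtain ⟨s, hs⟩ := hout
  have : Sum.inr p = (Sum.inr (a, m) : Decision k) := by
    rcases le_total t s with hts | hst
    · rw [← hs, history_of_stop_of_le A μ ω h hts, h]
    · rw [← h, history_of_stop_of_le A μ ω hs hst, hs]
  rw [Sum.inr.inj this]

theorem length_history_le (t : ℕ) : (A.history μ ω t).length ≤ t := by
  induction t with
  | zero => simp [history]
  | succ t ih =>
    rcases h : A.decide ω (A.history μ ω t) with i | p
    · simp [history_succ_of_query A μ ω h, ih]
    · rw [history_succ_of_stop A μ ω h]; omega

/-- A learner that has made fewer than `t` queries in `t` rounds has stopped. -/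
theorem exists_stop_of_length_lt {t : ℕ} (h : (A.history μ ω t).length < t) :
    ∃ p, A.decide ω (A.history μ ω t) = Sum.inr p := by
  induction t with
  | zero => simp at h
  | succ t ih =>
    rcases hd : A.decide ω (A.history μ ω t) with i | p
    · rw [history_succ_of_query A μ ω hd] at h
      obtain ⟨p, hp⟩ := ih (by simpa using h)
      simp [hp] at hd
    · exact ⟨p, by rw [history_succ_of_stop A μ ω hd, hd]⟩

theorem length_history_le_numQueries (t : ℕ) :
    ((A.history μ ω t).length : ℝ≥0∞) ≤ A.numQueries μ ω :=
  le_iSup (fun t => ((A.history μ ω t).length : ℝ≥0∞)) t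

theorem exists_stop_of_numQueries_lt {t : ℕ} (h : A.numQueries μ ω < t) :
    ∃ p, A.decide ω (A.history μ ω t) = Sum.inr p :=
  exists_stop_of_length_lt A μ ω
    (by exact_mod_cast (length_history_le_numQueries A μ ω t).trans_lt h)

/-- Two reward vectors that agree on all queried actions produce the same history. -/
theorem history_congr {μ μ' : Fin k → ℝ} {t : ℕ}
    (h : ∀ p ∈ A.history μ ω t, μ' p.1 = μ p.1) : A.history μ' ω t = A.history μ ω t := by
  induction t with
  | zero => rfl
  | succ t ih =>
    rcases hd : A.decide ω (A.history μ ω t) with i | p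
    · rw [history_succ_of_query A μ ω hd] at h ⊢
      have ih := ih fun p hp => h p (by simp [hp])
      rw [history_succ_of_query A μ' ω (i := i) (by rw [ih, hd]), ih, h (i, μ i) (by simp)]
    · rw [history_succ_of_stop A μ ω hd] at h ⊢
      have ih := ih h
      rw [history_succ_of_stop A μ' ω (p := p) (by rw [ih, hd]), ih]

/-- Noiseless rewards are determined by the actions, so for fixed `μ` only countably many histories
occur. This makes the measurability arguments below countable unions. -/
theorem exists_history_eq_map (t : ℕ) :
    ∃ l : List (Fin k), A.history μ ω t = l.map fun i => (i, μ i) := by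
  induction t with
  | zero => exact ⟨[], rfl⟩
  | succ t ih =>
    obtain ⟨l, hl⟩ := ih
    rcases hd : A.decide ω (A.history μ ω t) with i | p
    · exact ⟨l ++ [i], by simp [history_succ_of_query A μ ω hd, hl]⟩
    · exact ⟨l, by rw [history_succ_of_stop A μ ω hd, hl]⟩

/-- Induction on `t`, splitting on the last round: either the learner has already stopped at `h`, or
one query extended a shorter history to `h`. -/
theorem measurableSet_history_eq (t : ℕ) (h : List (Fin k × ℝ)) :
    MeasurableSet {ω | A.history μ ω t = h} := by
  induction t generalizing h with
  | zero => simp [history]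
  | succ t ih =>
    have : {ω | A.history μ ω (t + 1) = h} =
        ({ω | A.history μ ω t = h} ∩ (fun ω => A.decide ω h) ⁻¹' Set.range Sum.inr) ∪
        ⋃ (l : List (Fin k)) (i : Fin k) (_ : l.map (fun i => (i, μ i)) ++ [(i, μ i)] = h),
          ({ω | A.history μ ω t = l.map fun i => (i, μ i)} ∩
            (fun ω => A.decide ω (l.map fun i => (i, μ i))) ⁻¹' (Sum.inl '' {i})) := by
      ext ω
      simp only [Set.mem_ofPred_eq, Set.mem_union, Set.mem_inter_iff, Set.mem_preimage,
        Set.mem_range, Set.mem_iUnion, exists_prop, Set.image_singleton, Set.mem_singleton_iff]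
      constructor
      · intro hω
        rcases hd : A.decide ω (A.history μ ω t) with i | p
        · obtain ⟨l, hl⟩ := exists_history_eq_map A μ ω t
          rw [history_succ_of_query A μ ω hd] at hω
          exact Or.inr ⟨l, i, by rw [← hl, hω], hl, by rw [← hl, hd]⟩
        · rw [history_succ_of_stop A μ ω hd] at hω
          exact Or.inl ⟨hω, p, by rw [← hω, hd]⟩
      · rintro (⟨h1, p, h2⟩ | ⟨l, i, h0, h1, h2⟩)
        · rw [history_succ_of_stop A μ ω (p := p) (by rw [h1, h2]), h1]
        · rw [history_succ_of_query A μ ω (i := i) (by rw [h1, h2]), h1, h0]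
    rw [this]
    refine ((ih h).inter (A.measurable_decide h measurableSet_range_inr)).union ?_
    exact .iUnion fun l => .iUnion fun i => .iUnion fun _ => (ih _).inter
      (A.measurable_decide _ (measurableSet_inl_image.mpr (measurableSet_singleton i)))

theorem measurable_length_history (t : ℕ) : Measurable fun ω => (A.history μ ω t).length := by
  refine measurable_to_countable' fun n => ?_
  have : (fun ω => (A.history μ ω t).length) ⁻¹' {n} =
      ⋃ (l : List (Fin k)) (_ : l.length = n), {ω | A.history μ ω t = l.map fun i => (i, μ i)} := by
    ext ω
    simp only [Set.mem_preimage, Set.mem_singleton_iff, Set.mem_iUnion, Set.mem_ofPred_eq,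
      exists_prop]
    constructor
    · intro h
      obtain ⟨l, hl⟩ := exists_history_eq_map A μ ω t
      exact ⟨l, by simpa [hl] using h, hl⟩
    · rintro ⟨l, h, hl⟩
      simpa [hl] using h
  rw [this]
  exact .iUnion fun l => .iUnion fun _ => measurableSet_history_eq A μ t _

theorem measurable_numQueries : Measurable (A.numQueries μ) :=
  Measurable.iSup fun t => measurable_from_top.comp (measurable_length_history A μ t)

end Learner

/-! ### Lower bounds from needles -/

variable {k : ℕ}

theorem IsNearOptimal.lt_of_le {δ : ℝ} {μ : Fin k → ℝ} {a : Fin k} (h : IsNearOptimal δ μ a)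
    (i : Fin k) : μ i - δ < μ a := by
  have := le_ciSup (Set.finite_range μ).bddAbove i
  unfold IsNearOptimal at h
  linarith

/-- The only `δ`-optimal action of a needle of height `δ` is the needle itself. -/
theorem IsNearOptimal.eq_of_single {δ : ℝ} {i a : Fin k}
    (h : IsNearOptimal δ (Pi.single i δ) a) : a = i := by
  have := h.lt_of_le i
  by_contra hne
  simp [hne] at this

open Finset in
/-- For a fixed seed, at most `c + 1` needles are found with fewer than `c` queries. -/
theorem Learner.card_numQueries_lt_le (A : Learner k) (ω : A.Seed) (δ : ℝ) (S : Finset (Fin k))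
    (hS : ∀ i ∈ S, ∃ a m, A.Outputs (Pi.single i δ) ω a m ∧ IsNearOptimal δ (Pi.single i δ) a)
    (c : ℕ) [DecidablePred fun i => A.numQueries (Pi.single i δ) ω < c] :
    (S.filter fun i => A.numQueries (Pi.single i δ) ω < c).card ≤ c + 1 := by
  classical
  -- The reference run on the zero vector: a needle found cheaply is either queried in it (at most
  -- `c` of them) or is its output (at most one).
  set h := A.history 0 ω c with hh
  have hq : (h.map Prod.fst).toFinset.card ≤ c :=
    (List.toFinset_card_le _).trans (by simpa using A.length_history_le 0 ω c)
  have key : ∀ i ∈ S.filter fun i => A.numQueries (Pi.single i δ) ω < c,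
      i ∈ (h.map Prod.fst).toFinset ∨ ∃ m, A.decide ω h = Sum.inr (i, m) := by
    intro i hi
    obtain ⟨hiS, hi⟩ := mem_filter.mp hi
    refine or_iff_not_imp_left.mpr fun hnot => ?_
    have heq : A.history (Pi.single i δ) ω c = h := A.history_congr ω fun p hp => by
      rw [Pi.single_eq_of_ne, Pi.zero_apply]
      rintro rfl
      exact hnot (by simpa using ⟨p.2, hp⟩)
    obtain ⟨⟨b, m'⟩, hp⟩ := A.exists_stop_of_numQueries_lt _ ω hi
    obtain ⟨a, m, hout, hopt⟩ := hS i hiS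
    have hb := A.output_unique _ ω hp hout
    rw [hopt.eq_of_single] at hb
    exact ⟨m', by rw [← heq, hp, ← hb]⟩
  rcases hd : A.decide ω h with j | p
  · refine (card_le_card fun i hi => ?_).trans (hq.trans c.le_succ)
    exact (key i hi).resolve_right (by simp [hd])
  · refine (card_le_card fun i hi => ?_).trans
      ((card_insert_le p.1 (h.map Prod.fst).toFinset).trans (Nat.succ_le_succ hq))
    rcases key i hi with h1 | ⟨m, h1⟩
    · exact mem_insert_of_mem h1
    · rw [hd] at h1
      rw [Sum.inr.inj h1]
      exact mem_insert_self _ _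

open Finset in
/-- A needle hidden among `2 * (c + 1)` actions costs at least `c / 2` queries. -/
theorem le_queryComplexity_of_single_mem {δ : ℝ} {H : Set (Fin k → ℝ)} (S : Finset (Fin k))
    (c : ℕ) (hcard : S.card = 2 * (c + 1)) (hS : ∀ i ∈ S, Pi.single i δ ∈ H) :
    (c : ℝ≥0∞) / 2 ≤ queryComplexity δ H := by
  classical
  refine le_iInf₂ fun A hA => ?_
  have hae : ∀ᵐ ω ∂A.law, ((c + 1 : ℕ) * c : ℝ≥0∞) ≤
      ∑ i ∈ S, A.numQueries (Pi.single i δ) ω := by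
    have : ∀ᵐ ω ∂A.law, ∀ i ∈ S, ∃ a m,
        A.Outputs (Pi.single i δ) ω a m ∧ IsNearOptimal δ (Pi.single i δ) a :=
      (Finset.eventually_all S).mpr fun i hi => hA _ (hS i hi)
    filter_upwards [this] with ω hω
    -- At most `c + 1` of the `2 * (c + 1)` needles are cheap, so at least `c + 1` cost `c` or more.
    have h1 := A.card_numQueries_lt_le ω δ S hω c
    have h2 := card_filter_add_card_filter_not (s := S)
      (fun i => A.numQueries (Pi.single i δ) ω < c)
    calc ((c + 1 : ℕ) * c : ℝ≥0∞)
        ≤ (S.filter fun i => ¬ A.numQueries (Pi.single i δ) ω < c).card * c := by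
          gcongr
          omega
      _ = ∑ i ∈ S.filter fun i => ¬ A.numQueries (Pi.single i δ) ω < c, (c : ℝ≥0∞) := by simp
      _ ≤ ∑ i ∈ S.filter fun i => ¬ A.numQueries (Pi.single i δ) ω < c,
            A.numQueries (Pi.single i δ) ω :=
          sum_le_sum fun i hi => not_lt.mp (mem_filter.mp hi).2
      _ ≤ ∑ i ∈ S, A.numQueries (Pi.single i δ) ω :=
          sum_le_sum_of_subset (filter_subset _ _)
  have hsum : ((c + 1 : ℕ) * c : ℝ≥0∞) ≤
      (2 * (c + 1) : ℕ) * ⨆ μ ∈ H, A.expectedQueries μ := by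
    calc ((c + 1 : ℕ) * c : ℝ≥0∞)
        = ∫⁻ _, ((c + 1 : ℕ) * c : ℝ≥0∞) ∂A.law := by simp
      _ ≤ ∫⁻ ω, ∑ i ∈ S, A.numQueries (Pi.single i δ) ω ∂A.law := lintegral_mono_ae hae
      _ = ∑ i ∈ S, A.expectedQueries (Pi.single i δ) :=
          lintegral_finsetSum _ fun i _ => A.measurable_numQueries _
      _ ≤ ∑ _i ∈ S, ⨆ μ ∈ H, A.expectedQueries μ :=
          sum_le_sum fun i hi => le_iSup₂ (f := fun μ _ => A.expectedQueries μ) _ (hS i hi)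
      _ = _ := by rw [sum_const, hcard, nsmul_eq_mul]
  rw [ENNReal.div_le_iff (by simp) (by simp)]
  rw [Nat.cast_mul, mul_comm ((2 : ℕ) : ℝ≥0∞), mul_assoc] at hsum
  have := (ENNReal.mul_le_mul_iff_right (by simp) (by simp)).mp hsum
  rwa [mul_comm, Nat.cast_ofNat] at this

/-- If two reward vectors have no common `δ`-optimal action, then at least one query is needed. -/
theorem one_le_queryComplexity {δ : ℝ} {H : Set (Fin k → ℝ)} {μ ν : Fin k → ℝ} (hμ : μ ∈ H)
    (hν : ν ∈ H) (h : ∀ a, IsNearOptimal δ μ a → ¬ IsNearOptimal δ ν a) :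
    1 ≤ queryComplexity δ H := by
  refine le_iInf₂ fun A hA => le_trans ?_
    (le_iSup₂ (f := fun μ _ => A.expectedQueries μ) μ hμ)
  calc (1 : ℝ≥0∞) = ∫⁻ _, 1 ∂A.law := by simp
    _ ≤ A.expectedQueries μ := by
      refine lintegral_mono_ae ?_
      filter_upwards [hA μ hμ, hA ν hν] with ω ⟨a, m, ha, ha'⟩ ⟨b, m', hb, hb'⟩
      refine le_trans ?_ (A.length_history_le_numQueries μ ω 1)
      rcases hd : A.decide ω [] with i | p
      · simp [Learner.history, hd]
      · have h1 := A.output_unique μ ω (t := 0) hd ha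
        have h2 := A.output_unique ν ω (t := 0) hd hb
        exact absurd (h2.symm.trans h1 ▸ hb') (h a ha')

/-! ### Feature matrices -/

theorem mem_hypothesisClass {d : ℕ} {Φ : Matrix (Fin k) (Fin d) ℝ} {ε : ℝ} {μ : Fin k → ℝ}
    (θ : Fin d → ℝ) (h : ∀ i, |μ i - Φ i ⬝ᵥ θ| ≤ ε) : μ ∈ hypothesisClass Φ ε := by
  refine Set.mem_add.mpr ⟨Φ.mulVec θ, ⟨θ, rfl⟩, μ - Φ.mulVec θ, ⟨fun i => ?_, fun i => ?_⟩,
    add_sub_cancel _ _⟩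
  · exact (abs_le.mp (h i)).1
  · exact (abs_le.mp (h i)).2

/-- With one nontrivial feature and two opposite actions, at least one query is needed. -/
theorem exists_one_le_queryComplexity {d : ℕ} (hd : 1 ≤ d) {ε : ℝ} (δ : ℝ) (hε : 0 ≤ ε)
    (hk : 2 ≤ k) : ∃ Φ : Matrix (Fin k) (Fin d) ℝ, 1 ≤ queryComplexity δ (hypothesisClass Φ ε) := by
  let u : Fin k → ℝ := Pi.single ⟨0, by omega⟩ 1 - Pi.single ⟨1, by omega⟩ 1
  let Φ : Matrix (Fin k) (Fin d) ℝ := fun i => Pi.single ⟨0, hd⟩ (u i)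
  have hmem (x : ℝ) : x • u ∈ hypothesisClass Φ ε := by
    refine mem_hypothesisClass (Pi.single ⟨0, hd⟩ x) fun i => ?_
    simpa [Φ, mul_comm] using hε
  -- A common `δ`-optimal action `a` would need both `0 < δ * u a` and `0 < -δ * u a`.
  refine ⟨Φ, one_le_queryComplexity (hmem δ) (hmem (-δ)) fun a ha hb => ?_⟩
  have h1 := ha.lt_of_le ⟨0, by omega⟩
  have h2 := hb.lt_of_le ⟨1, by omega⟩
  simp [u] at h1 h2
  linarith

/-- Nearly orthogonal features make the needles consistent with the misspecified model. -/
theorem exists_single_mem_hypothesisClass {d n : ℕ} (hd : 1 ≤ d) {ε δ : ℝ} (hε : 0 ≤ ε)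
    (hδ : 0 < δ) (hn : 2 * n < Real.exp (d * (ε / δ) ^ 2 / 2)) (hk : n ≤ k) :
    ∃ Φ : Matrix (Fin k) (Fin d) ℝ, ∀ i : Fin n,
      Pi.single (Fin.castLE hk i) δ ∈ hypothesisClass Φ ε := by
  obtain ⟨f, hf, hr⟩ := exists_nearly_orthogonal_signVectors d n (div_nonneg hε hδ.le) hn
  have hd0 : (0 : ℝ) < d := by exact_mod_cast hd
  -- Surplus actions get the zero feature, where prediction and needle both vanish.
  refine ⟨fun j => if h : j.val < n then f ⟨j, h⟩ else 0, fun i => ?_⟩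
  refine mem_hypothesisClass ((δ / d) • f i) fun j => ?_
  by_cases h : j.val < n
  · obtain ⟨j, rfl⟩ : ∃ j' : Fin n, j = Fin.castLE hk j' := ⟨⟨j, h⟩, rfl⟩
    have : (Fin.castLE hk j).val < n := j.isLt
    simp only [this, dif_pos, dotProduct_smul, smul_eq_mul]
    change |_ - δ / d * (f j ⬝ᵥ f i)| ≤ ε
    rcases eq_or_ne j i with rfl | hji
    · rw [hf, Pi.single_eq_same, div_mul_cancel₀ _ hd0.ne', sub_self, abs_zero]
      exact hε
    · rw [Pi.single_eq_of_ne (fun h => hji (Fin.castLE_injective hk h)), zero_sub, abs_neg, abs_mul,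
        abs_of_pos (div_pos hδ hd0)]
      calc δ / d * |f j ⬝ᵥ f i| ≤ δ / d * (ε / δ * d) := by gcongr; exact hr j i hji
        _ = ε := by field_simp
  · rw [Pi.single_eq_of_ne (by rintro rfl; exact h i.isLt)]
    simpa [h] using hε

end MisspecifiedBandit

open MisspecifiedBandit in
theorem corollary3p3 (d : ℕ) (hd : 1 ≤ d) (ε δ : ℝ) (hε : 0 ≤ ε) (hδ : ε < δ) :
    ∃ K : ℕ, ∀ k : ℕ, K ≤ k → ∃ Φ : Matrix (Fin k) (Fin d) ℝ,
      ENNReal.ofReal (1 / 2 * Real.exp (((d : ℝ) - 1) / 8 * (ε / δ) ^ 2)) ≤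
        MisspecifiedBandit.queryComplexity δ (MisspecifiedBandit.hypothesisClass Φ ε) := by
  have hδ0 : 0 < δ := hε.trans_lt hδ
  set E := Real.exp (((d : ℝ) - 1) / 8 * (ε / δ) ^ 2) with hE
  -- If `E ≤ 2` the target is at most `1`. Otherwise take `c = ⌈E⌉₊` and `n = 2 * (c + 1)` needles.
  rcases le_or_gt E 2 with h2 | h2
  · refine ⟨2, fun k hk => ?_⟩
    obtain ⟨Φ, hΦ⟩ := exists_one_le_queryComplexity hd δ hε hk
    refine ⟨Φ, le_trans ?_ hΦ⟩
    rw [← ENNReal.ofReal_one]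
    exact ENNReal.ofReal_le_ofReal (by linarith)
  · have hc : (⌈E⌉₊ : ℝ) < E + 1 := Nat.ceil_lt_add_one (Real.exp_pos _).le
    -- The slack in the exponent: four times `(d - 1) / 8` is at most `d / 2`. Packing then fits, as
    -- `2 * n < 4 * E + 8 < 8 * E ≤ E ^ 4` for `E > 2`.
    have hpow : E ^ 4 ≤ Real.exp (d * (ε / δ) ^ 2 / 2) := by
      rw [hE, ← Real.exp_nat_mul]
      refine Real.exp_le_exp.mpr ?_
      push_cast
      nlinarith [sq_nonneg (ε / δ)]
    have h8 : 8 * E ≤ E ^ 4 := by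
      have : (2 : ℝ) ^ 3 ≤ E ^ 3 := by gcongr
      nlinarith
    refine ⟨2 * (⌈E⌉₊ + 1), fun k hk => ?_⟩
    obtain ⟨Φ, hΦ⟩ := exists_single_mem_hypothesisClass (ε := ε) hd hε hδ0
      (n := 2 * (⌈E⌉₊ + 1)) (by push_cast; linarith) hk
    refine ⟨Φ, le_trans ?_ (le_queryComplexity_of_single_mem
      (Finset.univ.map (Fin.castLEEmb hk)) ⌈E⌉₊ (by simp) (by simpa using hΦ))⟩
    rw [one_div_mul_eq_div, ENNReal.ofReal_div_of_pos two_pos, ENNReal.ofReal_ofNat]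
    gcongr
    exact ENNReal.ofReal_le_of_le_toReal (by simpa using Nat.le_ceil E)
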